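/- A \emph{left additive category} is a category whose hom-sets are commutative monoids $(+,0)$ such that precomposition preserves $+$ and $0$ (composition $f;g$ is written in diagrammatic order); a map $f$ is \emph{additive} if postcomposition with it preserves $+$ and $0$ too. A \emph{Cartesian left additive category} is a left additive category with (chosen) finite products all of whose projections $\pi_0,\pi_1$ are additive. A \emph{reverse derivative category} is a Cartesian left additive category with a \emph{reverse differential combinator} $R$, sending each $f:A\to B$ to a map $R[f]:A\times B\to A$, such that (with $\iota_0=\langle 1,0\rangle$, $\iota_1=\langle 0,1\rangle$ and $D[f]:=(\iota_0\times 1);R[R[f]];\pi_1:A\times A\to B$): 1. $R[f+g]=R[f]+R[g]$ and $R[0]=0$; 2. $\langle a,b+c\rangle;R[f]=\langle a,b\rangle;R[f]+\langle a,c\rangle;R[f]$ and $\langle a,0\rangle;R[f]=0$; 3. $R[1]=\pi_1$, $R[\pi_0]=\pi_1;\iota_0$, $R[\pi_1]=\pi_1;\iota_1$; 4. $R[\langle f,g\rangle]=(1\times\pi_0);R[f]+(1\times\pi_1);R[g]$, and $R[!_A]=0$ for the map $!_A$ to the terminal object; 5. $R[f;g]=\langle\pi_0,\langle\pi_0;f,\pi_1\rangle;R[g]\rangle;R[f]$;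 6. $\langle 1\times\pi_0,0\times\pi_1\rangle;((\iota_0\times 1)\times 1);R[R[R[f]]];\pi_1=(1\times\pi_1);R[f]$; 7. $D[D[f]]=\mathrm{ex};D[D[f]]$, where $\mathrm{ex}:(A\times A)\times(A\times A)\to(A\times A)\times(A\times A)$ interchanges the two middle factors. For an object $A$ of a category $\mathcal C$ with finite products, $\mathsf{CoKl}(A\times-)$ denotes the coKleisli category of the product comonad $A\times-$ (comultiplication $\Delta_A\times X$, counit $\pi_X$): it has the objects of $\mathcal C$, a map $X\to Y$ in it is a map $A\times X\to Y$ in $\mathcal C$, and its finite products are those of $\mathcal C$ with projections precomposed with the counit. \textbf{Theorem.} Let $\mathcal C$ be a reverse derivative category and let $A$ be an object of $\mathcal C$. Then $\mathsf{CoKl}(A\times-)$, with these finite products and with the addition and zero maps of the hom-sets $\mathcal C(A\times X,Y)$, is a reverse derivative category, whose reverse differential combinator sends $f\in\mathsf{CoKl}(A\times-)(X,Y)$, i.e. $f:A\times X\to Y$ in $\mathcal C$, to the map $X\times Y\to X$ of $\mathsf{CoKl}(A\times-)$ given in $\mathcal C$ by the composite $$A\times(X\times Y)\;\cong\;(A\times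 X)\times Y\xrightarrow{\;R_{\mathcal C}[f]\;}A\times X\xrightarrow{\;\pi_X\;}X .$$ -/

import Mathlib

open CategoryTheory MonoidalCategory CartesianMonoidalCategory Limits

universe v u

namespace RDC

/-! ### Cartesian left additive categories -/

/-- A left additive category: every hom-set is a commutative monoid, and precomposition
preserves the monoid structure. -/
class LeftAdditiveCategory (C : Type u) [Category.{v} C] where
  homAddCommMonoid (X Y : C) : AddCommMonoid (X ⟶ Y)
  comp_add {X Y Z : C} (f : X ⟶ Y) (g h : Y ⟶ Z) : f ≫ (g + h) = f ≫ g + f ≫ h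
  comp_zero {X Y : C} (f : X ⟶ Y) (Z : C) : f ≫ (0 : Y ⟶ Z) = 0

attribute [reducible, instance] LeftAdditiveCategory.homAddCommMonoid

/-- A map `f` in a left additive category is additive if postcomposition by `f` preserves the
monoid structure of hom-sets. -/
def IsAdditiveMap {C : Type u} [Category.{v} C] [LeftAdditiveCategory C] {X Y : C}
    (f : X ⟶ Y) : Prop :=
  (∀ (W : C) (g h : W ⟶ X), (g + h) ≫ f = g ≫ f + h ≫ f) ∧
    ∀ W : C, (0 : W ⟶ X) ≫ f = 0

/-- A Cartesian left additive category: a left additive category with (chosen) finite products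
all of whose projections are additive. -/
class CartesianLeftAdditiveCategory (C : Type u) [Category.{v} C]
    [CartesianMonoidalCategory C] extends LeftAdditiveCategory C where
  isAdditiveMap_fst (X Y : C) : IsAdditiveMap (fst X Y)
  isAdditiveMap_snd (X Y : C) : IsAdditiveMap (snd X Y)

section Combinators

variable {C : Type u} [Category.{v} C] [CartesianMonoidalCategory C]

/-- The interchange map `(A × B) × (D × E) ⟶ (A × D) × (B × E)`. -/
def interchange (A B D E : C) : (A ⊗ B) ⊗ (D ⊗ E) ⟶ (A ⊗ D) ⊗ (B ⊗ E) :=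
  lift (fst A B ⊗ₘ fst D E) (snd A B ⊗ₘ snd D E)

variable [CartesianLeftAdditiveCategory C]

/-- The injection `⟨1, 0⟩ : A ⟶ A × B`. -/
def inj₀ (A B : C) : A ⟶ A ⊗ B := lift (𝟙 A) 0

/-- The injection `⟨0, 1⟩ : B ⟶ A × B`. -/
def inj₁ (A B : C) : B ⟶ A ⊗ B := lift 0 (𝟙 B)

/-- The forward derivative `D[f] : A × A ⟶ B` of `f : A ⟶ B` obtained from an operator `R`
sending `f : A ⟶ B` to `R[f] : A × B ⟶ A`; it is the composite
`A × A ⟶ (A × B) × A ⟶ A × B ⟶ B` of `⟨1, 0⟩ × 1`, `R[R[f]]` and the second projection. -/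
def forwardOf (R : ∀ {A B : C}, (A ⟶ B) → (A ⊗ B ⟶ A)) {A B : C} (f : A ⟶ B) : A ⊗ A ⟶ B :=
  (inj₀ A B ▷ A) ≫ R (R f) ≫ snd A B

end Combinators

/-! ### Reverse derivative categories -/

/-- A reverse derivative category: a Cartesian left additive category with a reverse
differential combinator, i.e. an operator `R` sending `f : A ⟶ B` to `R[f] : A × B ⟶ A` and
satisfying the seven axioms RD.1 - RD.7. -/
class ReverseDerivativeCategory (C : Type u) [Category.{v} C] [CartesianMonoidalCategory C]
    extends CartesianLeftAdditiveCategory C where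
  /-- The reverse differential combinator. -/
  R {A B : C} (f : A ⟶ B) : A ⊗ B ⟶ A
  /-- RD.1: `R` preserves sums. -/
  R_add {A B : C} (f g : A ⟶ B) : R (f + g) = R f + R g
  /-- RD.1: `R` preserves zero. -/
  R_zero (A B : C) : R (0 : A ⟶ B) = 0
  /-- RD.2: `R[f]` is additive in its second argument. -/
  lift_add_R {X A B : C} (f : A ⟶ B) (a : X ⟶ A) (b c : X ⟶ B) :
    lift a (b + c) ≫ R f = lift a b ≫ R f + lift a c ≫ R f
  /-- RD.2: `R[f]` preserves zero in its second argument. -/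
  lift_zero_R {X A B : C} (f : A ⟶ B) (a : X ⟶ A) : lift a (0 : X ⟶ B) ≫ R f = 0
  /-- RD.3: identities. -/
  R_id (A : C) : R (𝟙 A) = snd A A
  /-- RD.3: first projections. -/
  R_fst (A B : C) : R (fst A B) = snd (A ⊗ B) A ≫ inj₀ A B
  /-- RD.3: second projections. -/
  R_snd (A B : C) : R (snd A B) = snd (A ⊗ B) B ≫ inj₁ A B
  /-- RD.4: tuples. -/
  R_lift {X A B : C} (f : X ⟶ A) (g : X ⟶ B) :
    R (lift f g) = (X ◁ fst A B) ≫ R f + (X ◁ snd A B) ≫ R g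
  /-- RD.4: maps to the terminal object. -/
  R_toUnit (A : C) : R (toUnit A) = 0
  /-- RD.5: the reverse chain rule. -/
  R_comp {A B D : C} (f : A ⟶ B) (g : B ⟶ D) :
    R (f ≫ g) = lift (fst A D) (lift (fst A D ≫ f) (snd A D) ≫ R g) ≫ R f
  /-- RD.6: linearity of the derivative in its second argument. -/
  R_R_R {A B : C} (f : A ⟶ B) :
    lift (A ◁ fst A B) ((0 : A ⟶ A) ⊗ₘ snd A B) ≫ ((inj₀ A B ▷ A) ▷ (A ⊗ B)) ≫
        R (R (R f)) ≫ snd (A ⊗ B) A =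
      (A ◁ snd A B) ≫ R f
  /-- RD.7: symmetry of the second derivatives. -/
  forward_forward {A B : C} (f : A ⟶ B) :
    forwardOf R (forwardOf R f) = interchange A A A A ≫ forwardOf R (forwardOf R f)

/-! ### The coKleisli category of the product comonad -/

section CoKleisli

variable {C : Type u} [Category.{v} C] [CartesianMonoidalCategory C]

/-- The product comonad `A × -`, with comultiplication `Δ_A × X` and counit `π_X`. -/
@[reducible]
def productComonad (A : C) : Comonad C where
  toFunctor := tensorLeft A
  ε := { app := fun X => snd A X }
  δ := { app := fun X => (lift (𝟙 A) (𝟙 A) ▷ X) ≫ (α_ A A X).hom }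

/-- The coKleisli category `CoKl(A × -)`: an object is an object of `C`, and a map `X ⟶ Y` is a
map `A × X ⟶ Y` in `C`. -/
abbrev CoKl (A : C) : Type u := Cokleisli (productComonad A)

namespace CoKl

variable {A : C}

theorem comp_of_eq {X Y Z : CoKl A} (f : X ⟶ Y) (g : Y ⟶ Z) :
    (f ≫ g).of = lift (fst A X.of) f.of ≫ g.of := by
  have h : (f ≫ g).of =
      ((lift (𝟙 A) (𝟙 A) ▷ X.of) ≫ (α_ A A X.of).hom) ≫ (A ◁ f.of) ≫ g.of := rfl
  have h' : (lift (𝟙 A) (𝟙 A) ▷ X.of) ≫ (α_ A A X.of).hom = lift (fst A X.of) (𝟙 _) := by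
    ext <;> simp
  rw [h, h', lift_whiskerLeft_assoc, Category.id_comp]

/-- The terminal object of `C` is terminal in `CoKl(A × -)`. -/
@[reducible]
def terminalCone (A : C) : LimitCone (Functor.empty.{0} (CoKl A)) where
  cone := asEmptyCone (Cokleisli.mk _ (𝟙_ C))
  isLimit := IsTerminal.ofUniqueHom (fun _ => Cokleisli.Hom.mk (toUnit _))
    fun _ _ => Cokleisli.hom_ext _ (toUnit_unique _ _)

/-- Binary products in `CoKl(A × -)` are the products of `C`, with projections
`A × (X × Y) ⟶ X × Y ⟶ X` and `A × (X × Y) ⟶ X × Y ⟶ Y`. -/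
@[reducible]
def productCone (X Y : CoKl A) : LimitCone (pair X Y) where
  cone := BinaryFan.mk (P := Cokleisli.mk _ (X.of ⊗ Y.of))
    (Cokleisli.Hom.mk (snd A (X.of ⊗ Y.of) ≫ fst X.of Y.of))
    (Cokleisli.Hom.mk (snd A (X.of ⊗ Y.of) ≫ snd X.of Y.of))
  isLimit := BinaryFan.IsLimit.mk _
    (fun f g => Cokleisli.Hom.mk (lift f.of g.of))
    (fun f g => Cokleisli.hom_ext _ (by rw [comp_of_eq]; simp))
    (fun f g => Cokleisli.hom_ext _ (by rw [comp_of_eq]; simp))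
    (fun f g m hf hg => Cokleisli.hom_ext _ (by
      subst hf hg
      rw [comp_of_eq, comp_of_eq]
      refine CartesianMonoidalCategory.hom_ext _ _ ?_ ?_
      · simp
      · simp))

instance (A : C) : CartesianMonoidalCategory (CoKl A) :=
  .ofChosenFiniteProducts (terminalCone A) productCone

end CoKl

end CoKleisli

end RDC

/-!
A map `f : A × X ⟶ Y` is a map of `CoKl(A × -)` from `X` to `Y`, and the proposed combinator is
the partial reverse derivative `R_A[f](a, (x, y)) = π₁ R[f]((a, x), y)`.

The axioms RD.1 - RD.5 for `R_A` follow directly from the same axioms for `R`. For RD.6 and RD.7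
the point is that the bookkeeping maps that occur (reassociations, projections, injections) are
linear: such a map `h : X ⟶ Y` has a transpose `t : Y ⟶ X` with `R[h] = π₁; t` (`IsTranspose`), and
the chain rule then moves `h` out of `R` (`IsTranspose.R_comp_comp`) and, when `t` in turn has
transpose `h`, out of the forward derivative (`IsTranspose.forwardOf_comp`). Hence

* `R_A[R_A[f]](a, ((x, y), x'))` is `R[R[f]](((a, x), y), (0, x'))` without its `A`-component
  (`partialR_partialR`), so `D_A[f](a, (x, x')) = D[f]((a, x), (0, x'))` (`partialForward_eq`);
* `R_A[R_A[R_A[f]]]` is `R[R[R[f]]]` composed with linear maps on both sides, so that RD.6 for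
  `R_A` is the instance of RD.6 for `R` in which the direction in `A` vanishes;
* `D_A[D_A[f]](a, ((x, x'), (y, y')))` is
  `D[D[f]](((a, x), (0, x')), ((0, y), (0, y')))`, and RD.7 for `R_A` is an instance of RD.7
  for `R`.
-/

namespace RDC

section CartesianLeftAdditive

variable {C : Type u} [Category.{v} C]

section LeftAdditive

variable [LeftAdditiveCategory C]

@[simp]
theorem comp_add' {X Y Z : C} (f : X ⟶ Y) (g h : Y ⟶ Z) : f ≫ (g + h) = f ≫ g + f ≫ h :=
  LeftAdditiveCategory.comp_add f g h

@[simp]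
theorem comp_zero' {X Y Z : C} (f : X ⟶ Y) : f ≫ (0 : Y ⟶ Z) = 0 :=
  LeftAdditiveCategory.comp_zero f Z

end LeftAdditive

variable [CartesianMonoidalCategory C] [CartesianLeftAdditiveCategory C]

@[simp]
theorem add_fst {W X Y : C} (f g : W ⟶ X ⊗ Y) :
    (f + g) ≫ fst X Y = f ≫ fst X Y + g ≫ fst X Y :=
  (CartesianLeftAdditiveCategory.isAdditiveMap_fst X Y).1 W f g

@[simp]
theorem add_snd {W X Y : C} (f g : W ⟶ X ⊗ Y) :
    (f + g) ≫ snd X Y = f ≫ snd X Y + g ≫ snd X Y :=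
  (CartesianLeftAdditiveCategory.isAdditiveMap_snd X Y).1 W f g

@[simp]
theorem zero_fst {W X Y : C} : (0 : W ⟶ X ⊗ Y) ≫ fst X Y = 0 :=
  (CartesianLeftAdditiveCategory.isAdditiveMap_fst X Y).2 W

@[simp]
theorem zero_snd {W X Y : C} : (0 : W ⟶ X ⊗ Y) ≫ snd X Y = 0 :=
  (CartesianLeftAdditiveCategory.isAdditiveMap_snd X Y).2 W

@[simp]
theorem add_snd_assoc {W X Y Z : C} (f g : W ⟶ X ⊗ Y) (h : Y ⟶ Z) :
    (f + g) ≫ snd X Y ≫ h = (f ≫ snd X Y + g ≫ snd X Y) ≫ h := by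
  rw [← Category.assoc, add_snd]

@[simp]
theorem comp_inj₀ {W X : C} (f : W ⟶ X) (Y : C) : f ≫ inj₀ X Y = lift f 0 := by
  simp [inj₀, comp_lift]

@[simp]
theorem comp_inj₁ {W Y : C} (f : W ⟶ Y) (X : C) : f ≫ inj₁ X Y = lift 0 f := by
  simp [inj₁, comp_lift]

end CartesianLeftAdditive

/-! ### Linear maps and their transposes -/

section Transpose

variable {C : Type u} [Category.{v} C] [CartesianMonoidalCategory C]
  [ReverseDerivativeCategory C]

open ReverseDerivativeCategory

/-- `t` is the transpose of the (linear) map `h`: the reverse derivative of `h` does not depend on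
the base point, and is `t` at every base point. -/
def IsTranspose {X Y : C} (h : X ⟶ Y) (t : Y ⟶ X) : Prop :=
  R h = snd X Y ≫ t

namespace IsTranspose

theorem fst (X Y : C) : IsTranspose (fst X Y) (inj₀ X Y) := R_fst X Y

theorem snd (X Y : C) : IsTranspose (snd X Y) (inj₁ X Y) := R_snd X Y

theorem zero (X Y : C) : IsTranspose (0 : X ⟶ Y) 0 := by
  simp [IsTranspose, R_zero]

theorem comp {X Y Z : C} {h : X ⟶ Y} {k : Y ⟶ Z} {s : Y ⟶ X} {t : Z ⟶ Y}
    (hs : IsTranspose h s) (kt : IsTranspose k t) : IsTranspose (h ≫ k) (t ≫ s) := by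
  unfold IsTranspose at *
  simp [R_comp, hs, kt]

theorem lift {X Y Z : C} {h : X ⟶ Y} {k : X ⟶ Z} {s : Y ⟶ X} {t : Z ⟶ X}
    (hs : IsTranspose h s) (kt : IsTranspose k t) :
    IsTranspose (lift h k)
      (CartesianMonoidalCategory.fst Y Z ≫ s + CartesianMonoidalCategory.snd Y Z ≫ t) := by
  unfold IsTranspose at *
  simp [R_lift, hs, kt]

/-- The chain rule for a map pre- and postcomposed with linear maps. -/
theorem R_comp_comp {W X Y Z : C} {h : W ⟶ X} {s : X ⟶ W} {k : Y ⟶ Z} {t : Z ⟶ Y}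
    (hs : IsTranspose h s) (kt : IsTranspose k t) (g : X ⟶ Y) :
    R (h ≫ g ≫ k) = CartesianMonoidalCategory.lift (CartesianMonoidalCategory.fst W Z ≫ h)
      (CartesianMonoidalCategory.snd W Z ≫ t) ≫ R g ≫ s := by
  unfold IsTranspose at *
  simp only [R_comp, hs, kt, lift_snd_assoc, Category.assoc]
  simp only [← Category.assoc, comp_lift, lift_fst, lift_snd]

theorem R_comp {W X Y : C} {h : W ⟶ X} {s : X ⟶ W} (hs : IsTranspose h s) (g : X ⟶ Y) :
    R (h ≫ g) = CartesianMonoidalCategory.lift (CartesianMonoidalCategory.fst W Y ≫ h)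
      (CartesianMonoidalCategory.snd W Y) ≫ R g ≫ s := by
  unfold IsTranspose at *
  simp [ReverseDerivativeCategory.R_comp, hs]

/-- The chain rule `D[h; g](p, q) = D[g](h p, h q)` for a linear map `h`. -/
theorem forwardOf_comp {W X Y : C} {h : W ⟶ X} {s : X ⟶ W} (hs : IsTranspose h s)
    (sh : IsTranspose s h) (g : X ⟶ Y) :
    forwardOf R (h ≫ g) = (h ⊗ₘ h) ≫ forwardOf R g := by
  have hl := (((IsTranspose.fst W Y).comp hs).lift (IsTranspose.snd W Y))
  simp only [forwardOf, hs.R_comp, hl.R_comp_comp sh, Category.assoc]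
  simp only [add_snd, inj₀, comp_lift, comp_lift_assoc, inj₁, lift_snd,
    comp_zero', zero_add, Category.comp_id, whiskerRight_fst_assoc, whiskerRight_snd_assoc,
    lift_fst_assoc]
  simp only [← Category.assoc]
  congr 3
  apply CartesianMonoidalCategory.hom_ext
  · apply CartesianMonoidalCategory.hom_ext <;> simp
  · simp

end IsTranspose

end Transpose

/-! ### The partial reverse derivative -/

section PartialR

variable {C : Type u} [Category.{v} C] [CartesianMonoidalCategory C]
  [ReverseDerivativeCategory C]

open ReverseDerivativeCategory

/-- The reverse derivative of `f : A × X ⟶ Y` with respect to `X`, as a map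
`A × (X × Y) ⟶ X`. -/
def partialR {A X Y : C} (f : A ⊗ X ⟶ Y) : A ⊗ (X ⊗ Y) ⟶ X :=
  (α_ A X Y).inv ≫ R f ≫ snd A X

theorem lift_partialR {W A X Y : C} (f : A ⊗ X ⟶ Y) (a : W ⟶ A) (x : W ⟶ X) (y : W ⟶ Y) :
    lift a (lift x y) ≫ partialR f = lift (lift a x) y ≫ R f ≫ snd A X := by
  simp [partialR]

theorem isTranspose_associator_inv (A X Y : C) : IsTranspose (α_ A X Y).inv (α_ A X Y).hom := by
  have e : (α_ A X Y).inv =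
      lift (lift (fst _ _) (snd _ _ ≫ fst _ _)) (snd _ _ ≫ snd _ _) := by
    apply CartesianMonoidalCategory.hom_ext
    · apply CartesianMonoidalCategory.hom_ext <;> simp
    · simp
  rw [e]
  convert ((IsTranspose.fst A (X ⊗ Y)).lift ((IsTranspose.snd A (X ⊗ Y)).comp
    (IsTranspose.fst X Y))).lift ((IsTranspose.snd A (X ⊗ Y)).comp (IsTranspose.snd X Y)) using 1
  apply CartesianMonoidalCategory.hom_ext
  · simp [inj₀, inj₁]
  · apply CartesianMonoidalCategory.hom_ext <;> simp [inj₀, inj₁]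

/-- `R_A[R_A[f]](a, ((x, y), x'))` is the `X × Y`-component of `R[R[f]](((a, x), y), (0, x'))`. -/
theorem partialR_partialR {A X Y : C} (f : A ⊗ X ⟶ Y) :
    partialR (partialR f) =
      lift ((A ◁ fst (X ⊗ Y) X) ≫ (α_ A X Y).inv) (lift 0 (snd _ _ ≫ snd _ _)) ≫
        R (R f) ≫ (snd A X ▷ Y) := by
  have e : (α_ A X Y).hom ≫ snd A (X ⊗ Y) = snd A X ▷ Y := by
    apply CartesianMonoidalCategory.hom_ext <;> simp
  rw [partialR, partialR, (isTranspose_associator_inv A X Y).R_comp_comp (IsTranspose.snd A X)]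
  simp only [Category.assoc, e]
  simp only [← Category.assoc]
  congr 2
  apply CartesianMonoidalCategory.hom_ext
  · apply CartesianMonoidalCategory.hom_ext
    · apply CartesianMonoidalCategory.hom_ext <;> simp
    · simp
  · simp

/-- The map `(a, (x, x')) ↦ ((a, x), (0, x'))`. -/
def partialDirection (A X : C) : A ⊗ (X ⊗ X) ⟶ (A ⊗ X) ⊗ (A ⊗ X) :=
  lift (A ◁ fst X X) (lift 0 (snd _ _ ≫ snd _ _))

/-- The transpose `((a, x), (a', x')) ↦ (a, (x, x'))` of `partialDirection`. -/
def partialDirectionTranspose (A X : C) : (A ⊗ X) ⊗ (A ⊗ X) ⟶ A ⊗ (X ⊗ X) :=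
  lift (fst _ _ ≫ fst _ _) (lift (fst _ _ ≫ snd _ _) (snd _ _ ≫ snd _ _))

theorem isTranspose_whiskerLeft_fst (A X Y : C) : IsTranspose (A ◁ fst X Y) (A ◁ inj₀ X Y) := by
  have e : A ◁ fst X Y = lift (fst _ _) (snd _ _ ≫ fst _ _) := by
    apply CartesianMonoidalCategory.hom_ext <;> simp
  rw [e]
  convert (IsTranspose.fst A (X ⊗ Y)).lift
    ((IsTranspose.snd A (X ⊗ Y)).comp (IsTranspose.fst X Y)) using 1
  apply CartesianMonoidalCategory.hom_ext <;> simp [inj₀, inj₁]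

theorem isTranspose_partialDirection (A X : C) :
    IsTranspose (partialDirection A X) (partialDirectionTranspose A X) := by
  rw [partialDirection, partialDirectionTranspose]
  convert (isTranspose_whiskerLeft_fst A X X).lift ((IsTranspose.zero _ A).lift
    ((IsTranspose.snd A (X ⊗ X)).comp (IsTranspose.snd X X))) using 1
  apply CartesianMonoidalCategory.hom_ext
  · simp [inj₁]
  · apply CartesianMonoidalCategory.hom_ext <;> simp [inj₀, inj₁]

theorem isTranspose_partialDirectionTranspose (A X : C) :
    IsTranspose (partialDirectionTranspose A X) (partialDirection A X) := by
  rw [partialDirection, partialDirectionTranspose]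
  convert ((IsTranspose.fst (A ⊗ X) (A ⊗ X)).comp (IsTranspose.fst A X)).lift
    (((IsTranspose.fst (A ⊗ X) (A ⊗ X)).comp (IsTranspose.snd A X)).lift
      ((IsTranspose.snd (A ⊗ X) (A ⊗ X)).comp (IsTranspose.snd A X))) using 1
  apply CartesianMonoidalCategory.hom_ext <;> apply CartesianMonoidalCategory.hom_ext <;>
    simp [inj₀, inj₁]

/-- The forward derivative of `f : A × X ⟶ Y` with respect to `X`. -/
def partialForward {A X Y : C} (f : A ⊗ X ⟶ Y) : A ⊗ (X ⊗ X) ⟶ Y :=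
  (A ◁ (inj₀ X Y ▷ X)) ≫ partialR (partialR f) ≫ snd X Y

/-- `D_A[f](a, (x, x')) = D[f]((a, x), (0, x'))`. -/
theorem partialForward_eq {A X Y : C} (f : A ⊗ X ⟶ Y) :
    partialForward f = partialDirection A X ≫ forwardOf R f := by
  rw [partialForward, partialR_partialR, forwardOf]
  simp only [Category.assoc, whiskerRight_snd]
  simp only [← Category.assoc]
  congr 2
  apply CartesianMonoidalCategory.hom_ext
  · apply CartesianMonoidalCategory.hom_ext
    · apply CartesianMonoidalCategory.hom_ext <;> simp [partialDirection, inj₀]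
    · simp [partialDirection, inj₀]
  · simp [partialDirection, comp_lift]

/-- `D_A[D_A[f]](a, ((x, x'), (y, y'))) = D[D[f]](((a, x), (0, x')), ((0, y), (0, y')))`. -/
theorem partialForward_partialForward {A X Y : C} (f : A ⊗ X ⟶ Y) :
    partialForward (partialForward f) =
      partialDirection A (X ⊗ X) ≫ (partialDirection A X ⊗ₘ partialDirection A X) ≫
        forwardOf R (forwardOf R f) := by
  rw [partialForward_eq, partialForward_eq f,
    (isTranspose_partialDirection A X).forwardOf_comp (isTranspose_partialDirectionTranspose A X)]

/-- RD.7 for the partial reverse derivative. -/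
theorem interchange_partialForward {A X Y : C} (f : A ⊗ X ⟶ Y) :
    partialForward (partialForward f) =
      (A ◁ interchange X X X X) ≫ partialForward (partialForward f) := by
  rw [partialForward_partialForward]
  -- the four arguments of `D[D[f]]` after the interchange are those of `D_A[D_A[f]]` with `x'` and
  -- `y` exchanged, since the `A`-components of both directions vanish
  conv_lhs => rw [forward_forward]
  simp only [← Category.assoc]
  congr 1
  apply CartesianMonoidalCategory.hom_ext <;> apply CartesianMonoidalCategory.hom_ext <;>
    apply CartesianMonoidalCategory.hom_ext <;> simp [partialDirection, interchange]

/-- RD.6 for the partial reverse derivative, as an identity of maps `A × (X × (X × Y)) ⟶ X`. -/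
theorem partialR_partialR_partialR {A X Y : C} (f : A ⊗ X ⟶ Y) :
    (A ◁ (lift (X ◁ fst X Y) ((0 : X ⟶ X) ⊗ₘ snd X Y) ≫ ((inj₀ X Y ▷ X) ▷ (X ⊗ Y)))) ≫
        partialR (partialR (partialR f)) ≫ snd (X ⊗ Y) X =
      (A ◁ (X ◁ snd X Y)) ≫ partialR f := by
  -- `R_A[R_A[f]]` is `R[R[f]]` between the linear maps `(a, ((x, y), x')) ↦ (((a, x), y), (0, x'))`
  -- and `((a, x), y) ↦ (x, y)`; the transposes of these are `hk` and `hl`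
  have hk := ((isTranspose_whiskerLeft_fst A (X ⊗ Y) X).comp
    (isTranspose_associator_inv A X Y)).lift ((IsTranspose.zero _ A).lift
      ((IsTranspose.snd A ((X ⊗ Y) ⊗ X)).comp (IsTranspose.snd (X ⊗ Y) X)))
  have hl : IsTranspose (snd A X ▷ Y) (inj₁ A X ▷ Y) := by
    have e : snd A X ▷ Y = lift (fst _ _ ≫ snd _ _) (snd _ _) := by
      apply CartesianMonoidalCategory.hom_ext <;> simp
    rw [e]
    convert ((IsTranspose.fst (A ⊗ X) Y).comp (IsTranspose.snd A X)).lift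
      (IsTranspose.snd (A ⊗ X) Y) using 1
    apply CartesianMonoidalCategory.hom_ext <;> simp [inj₀, inj₁]
  rw [partialR_partialR f, partialR, hk.R_comp_comp hl]
  -- RD.6 for `R` at the point `(a, x)`, in the direction `(0, x')`, with covector `y`
  have h6 := congrArg (fun m => lift (A ◁ fst X (X ⊗ Y))
    (lift (lift 0 (snd _ _ ≫ snd _ _ ≫ fst _ _)) (snd _ _ ≫ snd _ _ ≫ snd _ _)) ≫ m ≫ snd A X)
      (R_R_R f)
  simp only [Category.assoc] at h6
  refine Eq.trans ?_ (h6.trans ?_)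
  · -- the transpose in `hk` has last component `(((a, x), y), (a', x')) ↦ x'`
    have ht : (fst ((A ⊗ X) ⊗ Y) (A ⊗ X) ≫ (α_ A X Y).hom ≫ (A ◁ inj₀ (X ⊗ Y) X) +
        snd ((A ⊗ X) ⊗ Y) (A ⊗ X) ≫ (fst A X ≫ 0 + snd A X ≫ inj₁ (X ⊗ Y) X ≫
          inj₁ A ((X ⊗ Y) ⊗ X))) ≫ snd A ((X ⊗ Y) ⊗ X) ≫ snd (X ⊗ Y) X = snd _ _ ≫ snd _ _ := by
      simp [inj₀, inj₁]
    simp only [Category.assoc, ht]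
    simp only [← Category.assoc]
    congr 3
    apply CartesianMonoidalCategory.hom_ext
    · apply CartesianMonoidalCategory.hom_ext
      · apply CartesianMonoidalCategory.hom_ext
        · apply CartesianMonoidalCategory.hom_ext <;> simp [inj₀]
        · simp [inj₀]
      · apply CartesianMonoidalCategory.hom_ext <;> simp
    · apply CartesianMonoidalCategory.hom_ext
      · apply CartesianMonoidalCategory.hom_ext <;> simp [inj₁]
      · simp
  · simp only [← Category.assoc, partialR]
    congr 2
    apply CartesianMonoidalCategory.hom_ext
    · apply CartesianMonoidalCategory.hom_ext <;> simp
    · simp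

theorem partialR_add {A X Y : C} (f g : A ⊗ X ⟶ Y) :
    partialR (f + g) = partialR f + partialR g := by
  simp [partialR, R_add]

theorem partialR_zero (A X Y : C) : partialR (0 : A ⊗ X ⟶ Y) = 0 := by
  simp [partialR, R_zero]

theorem partialR_of_isTranspose {A X Y : C} {h : A ⊗ X ⟶ Y} {t : Y ⟶ A ⊗ X}
    (ht : IsTranspose h t) : partialR h = snd A (X ⊗ Y) ≫ snd X Y ≫ t ≫ snd A X := by
  unfold IsTranspose at ht
  simp [partialR, ht]

theorem partialR_lift {A X Y Z : C} (f : A ⊗ X ⟶ Y) (g : A ⊗ X ⟶ Z) :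
    partialR (lift f g) = (A ◁ (X ◁ fst Y Z)) ≫ partialR f +
      (A ◁ (X ◁ snd Y Z)) ≫ partialR g := by
  simp [partialR, R_lift]

/-- RD.5 for the partial reverse derivative: the summand of `R[⟨π₀, f⟩; g]` that comes from `π₀`
lies in the factor `A`, and is discarded. -/
theorem partialR_comp {A X Y Z : C} (f : A ⊗ X ⟶ Y) (g : A ⊗ Y ⟶ Z) :
    partialR (lift (fst A X) f ≫ g) =
      lift (lift (fst A (X ⊗ Z)) (snd A (X ⊗ Z) ≫ fst X Z))
        (lift (lift (fst A (X ⊗ Z)) ((A ◁ fst X Z) ≫ f)) (snd A (X ⊗ Z) ≫ snd X Z) ≫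
          R g ≫ snd A Y) ≫ R f ≫ snd A X := by
  have e : (α_ A X Z).inv = lift (A ◁ fst X Z) (snd A (X ⊗ Z) ≫ snd X Z) := by
    apply CartesianMonoidalCategory.hom_ext
    · apply CartesianMonoidalCategory.hom_ext <;> simp
    · simp
  have e' : A ◁ fst X Z = lift (fst A (X ⊗ Z)) (snd A (X ⊗ Z) ≫ fst X Z) := by
    apply CartesianMonoidalCategory.hom_ext <;> simp
  simp [partialR, R_comp, R_lift, R_fst, e, e', -tensor_whiskerLeft, comp_lift_assoc]

end PartialR

/-! ### The reverse differential structure of the coKleisli category -/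

section CoKleisli

variable {C : Type u} [Category.{v} C] [CartesianMonoidalCategory C]

namespace CoKl

variable {A : C}

theorem comp_fst_of {W X Y : CoKl A} (f : W ⟶ X ⊗ Y) :
    (f ≫ fst X Y).of = f.of ≫ fst X.of Y.of := by
  rw [comp_of_eq]
  exact lift_snd_assoc _ _ (fst X.of Y.of)

theorem comp_snd_of {W X Y : CoKl A} (f : W ⟶ X ⊗ Y) :
    (f ≫ snd X Y).of = f.of ≫ snd X.of Y.of := by
  rw [comp_of_eq]
  exact lift_snd_assoc _ _ (snd X.of Y.of)

/-- `h` is the image of `p` under the identity-on-objects functor from `C` to `CoKl(A × -)`. -/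
def IsPure {X Y : CoKl A} (h : X ⟶ Y) (p : X.of ⟶ Y.of) : Prop :=
  h.of = snd A X.of ≫ p

namespace IsPure

theorem id (X : CoKl A) : IsPure (𝟙 X) (𝟙 X.of) :=
  (Category.comp_id (CartesianMonoidalCategory.snd A X.of)).symm

theorem fst (X Y : CoKl A) : IsPure (fst X Y) (fst X.of Y.of) := rfl

theorem snd (X Y : CoKl A) : IsPure (snd X Y) (snd X.of Y.of) := rfl

/-- Precomposition with the image of `p` is precomposition with `A × p`. -/
theorem comp_of {X Y Z : CoKl A} {h : X ⟶ Y} {p : X.of ⟶ Y.of} (hp : IsPure h p) (g : Y ⟶ Z) :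
    (h ≫ g).of = (A ◁ p) ≫ g.of := by
  rw [comp_of_eq, hp]
  congr 1
  apply CartesianMonoidalCategory.hom_ext <;> simp

theorem comp {X Y Z : CoKl A} {h : X ⟶ Y} {k : Y ⟶ Z} {p : X.of ⟶ Y.of} {q : Y.of ⟶ Z.of}
    (hp : IsPure h p) (kq : IsPure k q) : IsPure (h ≫ k) (p ≫ q) := by
  rw [IsPure, hp.comp_of, kq, whiskerLeft_snd_assoc]

theorem lift {W X Y : CoKl A} {h : W ⟶ X} {k : W ⟶ Y} {p : W.of ⟶ X.of} {q : W.of ⟶ Y.of}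
    (hp : IsPure h p) (kq : IsPure k q) : IsPure (lift h k) (lift p q) := by
  unfold IsPure at *
  rw [comp_lift, ← hp, ← kq]
  rfl

theorem tensorHom {W X Y Z : CoKl A} {h : W ⟶ X} {k : Y ⟶ Z} {p : W.of ⟶ X.of} {q : Y.of ⟶ Z.of}
    (hp : IsPure h p) (kq : IsPure k q) : IsPure (h ⊗ₘ k) (p ⊗ₘ q) := by
  have e : h ⊗ₘ k = CartesianMonoidalCategory.lift
      (CartesianMonoidalCategory.fst W Y ≫ h) (CartesianMonoidalCategory.snd W Y ≫ k) := by
    apply CartesianMonoidalCategory.hom_ext <;> simp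
  have e' : p ⊗ₘ q = CartesianMonoidalCategory.lift
      (CartesianMonoidalCategory.fst W.of Y.of ≫ p)
      (CartesianMonoidalCategory.snd W.of Y.of ≫ q) := by
    apply CartesianMonoidalCategory.hom_ext <;> simp
  rw [e, e']
  exact ((IsPure.fst W Y).comp hp).lift ((IsPure.snd W Y).comp kq)

theorem whiskerLeft (W : CoKl A) {X Y : CoKl A} {h : X ⟶ Y} {p : X.of ⟶ Y.of}
    (hp : IsPure h p) : IsPure (W ◁ h) (W.of ◁ p) := by
  rw [← MonoidalCategory.id_tensorHom, ← MonoidalCategory.id_tensorHom]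
  exact (IsPure.id W).tensorHom hp

theorem whiskerRight {X Y : CoKl A} {h : X ⟶ Y} {p : X.of ⟶ Y.of}
    (hp : IsPure h p) (W : CoKl A) : IsPure (h ▷ W) (p ▷ W.of) := by
  rw [← MonoidalCategory.tensorHom_id, ← MonoidalCategory.tensorHom_id]
  exact hp.tensorHom (IsPure.id W)

theorem interchange (W X Y Z : CoKl A) :
    IsPure (interchange W X Y Z) (interchange W.of X.of Y.of Z.of) :=
  ((IsPure.fst W X).tensorHom (IsPure.fst Y Z)).lift
    ((IsPure.snd W X).tensorHom (IsPure.snd Y Z))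

end IsPure

section LeftAdditive

variable [CartesianLeftAdditiveCategory C]

-- The additive structure on `CoKl(A × -)` is a scoped instance, so that where a reverse derivative
-- structure on `CoKl(A × -)` is quantified over, its own sums are the only ones in sight.
scoped instance homAdd (X Y : CoKl A) : Add (X ⟶ Y) where
  add f g := Cokleisli.Hom.mk (f.of + g.of : A ⊗ X.of ⟶ Y.of)

scoped instance homZero (X Y : CoKl A) : Zero (X ⟶ Y) where
  zero := Cokleisli.Hom.mk (0 : A ⊗ X.of ⟶ Y.of)

scoped instance homAddCommMonoid (X Y : CoKl A) : AddCommMonoid (X ⟶ Y) where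
  add_assoc _ _ _ := Cokleisli.hom_ext _ (add_assoc _ _ _)
  zero_add _ := Cokleisli.hom_ext _ (zero_add _)
  add_zero _ := Cokleisli.hom_ext _ (add_zero _)
  add_comm _ _ := Cokleisli.hom_ext _ (add_comm _ _)
  nsmul := nsmulRec

theorem add_of {X Y : CoKl A} (f g : X ⟶ Y) :
    (f + g).of = (f.of + g.of : A ⊗ X.of ⟶ Y.of) := rfl

theorem zero_of {X Y : CoKl A} : (0 : X ⟶ Y).of = (0 : A ⊗ X.of ⟶ Y.of) := rfl

scoped instance cartesianLeftAdditiveCategory : CartesianLeftAdditiveCategory (CoKl A) where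
  homAddCommMonoid := inferInstance
  comp_add f g h := Cokleisli.hom_ext _ (by
    rw [comp_of_eq, add_of, add_of, comp_of_eq, comp_of_eq]
    exact LeftAdditiveCategory.comp_add _ _ _)
  comp_zero f Z := Cokleisli.hom_ext _ (by
    rw [comp_of_eq, zero_of, zero_of]
    exact LeftAdditiveCategory.comp_zero _ _)
  isAdditiveMap_fst X Y :=
    ⟨fun W g h => Cokleisli.hom_ext _ (by
      rw [comp_fst_of, add_of (g ≫ _), comp_fst_of, comp_fst_of]; exact add_fst _ _),
    fun W => Cokleisli.hom_ext _ (by rw [comp_fst_of]; exact zero_fst)⟩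
  isAdditiveMap_snd X Y :=
    ⟨fun W g h => Cokleisli.hom_ext _ (by
      rw [comp_snd_of, add_of (g ≫ _), comp_snd_of, comp_snd_of]; exact add_snd _ _),
    fun W => Cokleisli.hom_ext _ (by rw [comp_snd_of]; exact zero_snd)⟩

theorem IsPure.zero (X Y : CoKl A) : IsPure (0 : X ⟶ Y) (0 : X.of ⟶ Y.of) :=
  (LeftAdditiveCategory.comp_zero _ _).symm

theorem IsPure.inj₀ (X Y : CoKl A) : IsPure (inj₀ X Y) (inj₀ X.of Y.of) :=
  (IsPure.id X).lift (IsPure.zero X Y)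

theorem IsPure.inj₁ (X Y : CoKl A) : IsPure (inj₁ X Y) (inj₁ X.of Y.of) :=
  (IsPure.zero Y X).lift (IsPure.id Y)

end LeftAdditive

variable [ReverseDerivativeCategory C]

/-- The partial reverse derivative as an operation on the maps of `CoKl(A × -)`. -/
def reverse {X Y : CoKl A} (f : X ⟶ Y) : X ⊗ Y ⟶ X :=
  Cokleisli.Hom.mk (partialR (A := A) (X := X.of) (Y := Y.of) f.of)

theorem reverse_of {X Y : CoKl A} (f : X ⟶ Y) :
    (reverse f).of = partialR (A := A) (X := X.of) (Y := Y.of) f.of := rfl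

theorem lift_comp_reverse_of {W X Y : CoKl A} (f : X ⟶ Y) (a : W ⟶ X) (b : W ⟶ Y) :
    (lift a b ≫ reverse f).of =
      lift (lift (fst A W.of) a.of) b.of ≫
        ReverseDerivativeCategory.R (A := A ⊗ X.of) (B := Y.of) f.of ≫ snd A X.of := by
  rw [comp_of_eq]
  exact lift_partialR _ _ _ _

theorem forwardOf_reverse_of {X Y : CoKl A} (f : X ⟶ Y) :
    (forwardOf reverse f).of = partialForward (A := A) (X := X.of) (Y := Y.of) f.of := by
  rw [forwardOf, ((IsPure.inj₀ X Y).whiskerRight X).comp_of, comp_snd_of]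
  rfl

variable (A) in
/-- The reverse derivative category `CoKl(A × -)`. -/
@[reducible]
def reverseDerivativeCategory : ReverseDerivativeCategory (CoKl A) where
  toCartesianLeftAdditiveCategory := cartesianLeftAdditiveCategory
  R := reverse
  R_add f g := Cokleisli.hom_ext _ (partialR_add _ _)
  R_zero X Y := Cokleisli.hom_ext _ (partialR_zero _ _ _)
  lift_add_R f a b c := Cokleisli.hom_ext _ (by
    rw [add_of, lift_comp_reverse_of, lift_comp_reverse_of, lift_comp_reverse_of, add_of,
      ← Category.assoc, ReverseDerivativeCategory.lift_add_R, add_snd, Category.assoc,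
      Category.assoc])
  lift_zero_R f a := Cokleisli.hom_ext _ (by
    rw [lift_comp_reverse_of, zero_of, ← Category.assoc, ReverseDerivativeCategory.lift_zero_R,
      zero_snd, zero_of])
  R_id X := Cokleisli.hom_ext _ (by
    refine (partialR_of_isTranspose (IsTranspose.snd A X.of)).trans ?_
    simp only [inj₁, lift_snd, Category.comp_id]
    rfl)
  R_fst X Y := Cokleisli.hom_ext _ (by
    refine (partialR_of_isTranspose
      ((IsTranspose.snd A (X.of ⊗ Y.of)).comp (IsTranspose.fst X.of Y.of))).trans
      (Eq.trans ?_ ((IsPure.snd (X ⊗ Y) X).comp (IsPure.inj₀ X Y)).symm)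
    simp only [inj₁, lift_snd, Category.comp_id, Category.assoc]
    rfl)
  R_snd X Y := Cokleisli.hom_ext _ (by
    refine (partialR_of_isTranspose
      ((IsTranspose.snd A (X.of ⊗ Y.of)).comp (IsTranspose.snd X.of Y.of))).trans
      (Eq.trans ?_ ((IsPure.snd (X ⊗ Y) Y).comp (IsPure.inj₁ X Y)).symm)
    simp only [inj₁, lift_snd, Category.comp_id, Category.assoc]
    rfl)
  R_lift {W X Y} f g := Cokleisli.hom_ext _ (by
    rw [add_of, ((IsPure.fst X Y).whiskerLeft W).comp_of, ((IsPure.snd X Y).whiskerLeft W).comp_of]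
    exact partialR_lift _ _)
  R_toUnit X := Cokleisli.hom_ext _ (by
    have h : (toUnit X).of = (0 : A ⊗ X.of ⟶ 𝟙_ C) := toUnit_unique _ _
    rw [reverse_of, h]
    exact partialR_zero _ _ _)
  R_comp {X Y Z} f g := Cokleisli.hom_ext _ (by
    rw [lift_comp_reverse_of, lift_comp_reverse_of, (IsPure.fst X Z).comp_of, reverse_of,
      comp_of_eq]
    exact partialR_comp _ _)
  R_R_R {X Y} f := Cokleisli.hom_ext _ (by
    rw [((IsPure.snd X Y).whiskerLeft X).comp_of, ← Category.assoc,
      ((((IsPure.fst X Y).whiskerLeft X).lift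
        ((IsPure.zero X X).tensorHom (IsPure.snd X Y))).comp
        (((IsPure.inj₀ X Y).whiskerRight X).whiskerRight (X ⊗ Y))).comp_of, comp_snd_of]
    exact partialR_partialR_partialR _)
  forward_forward {X Y} f := Cokleisli.hom_ext _ (by
    rw [(IsPure.interchange X X X X).comp_of, forwardOf_reverse_of, forwardOf_reverse_of]
    exact interchange_partialForward _)

end CoKl

end CoKleisli

end RDC

theorem mainTheorem2 {C : Type u} [Category.{v} C] [CartesianMonoidalCategory C]
    [RDC.ReverseDerivativeCategory C] (A : C) :
    ∃ S : RDC.ReverseDerivativeCategory (RDC.CoKl A),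
      (∀ X Y : RDC.CoKl A, (0 : X ⟶ Y).of = (0 : A ⊗ X.of ⟶ Y.of)) ∧
      (∀ (X Y : RDC.CoKl A) (f g : X ⟶ Y),
        (f + g).of = ((f.of + g.of : A ⊗ X.of ⟶ Y.of))) ∧
      ∀ (X Y : RDC.CoKl A) (f : X ⟶ Y),
        (S.R f).of = (α_ A X.of Y.of).inv ≫
          RDC.ReverseDerivativeCategory.R (A := A ⊗ X.of) (B := Y.of) f.of ≫ snd A X.of :=
  ⟨RDC.CoKl.reverseDerivativeCategory A, fun _ _ => rfl, fun _ _ _ _ => rfl, fun _ _ _ => rfl⟩
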